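/- Consider a position auction with $k$ positions and $n>k$ agents. Let $\alpha,\beta\in\mathbb{R}^k$ have positive, non-increasing entries, and put $\alpha_j=\beta_j=0$ for $j>k$. The values $v_1,\dots,v_n$ of the agents are independent and identically distributed, with a distribution that has a density and support $[0,\bar v]$, $0<\bar v<\infty$, and whose cumulative distribution function has three derivatives that exist and are bounded on $(0,\bar v)$. Given a bid profile $b\in\mathbb{R}^n$, a fixed allocation rule $g$ assigns positions $1,\dots,n$ to the agents one-to-one in non-increasing order of their bids, breaking ties in an arbitrary fixed way (positions beyond $k$ are worthless). Write $b_{(j)}$ for the $j$-th largest bid. The $\alpha$-VCG mechanism and the $\alpha$-GFP mechanism both use $g$ and charge agent $i$, respectively, $$p^V_i(b)=\sum_{j=g_i(b)}^{k}(\alpha_j-\alpha_{j+1})\,b_{(j+1)}\qquad\text{and}\qquad p^F_i(b)=\alpha_{g_i(b)}\,b_i .$$ Agent $i$ with value $v_i$ has utility $\beta_{g_i(b)}v_i-p_i(b)$. A bidding function $\mathfrak b:\mathbb{R}\to\mathbb{R}$, used by all agents, is a Bayes-Nash equilibrium if, for every agent $i$ and every value $v_i\in[0,\bar v]$, the bid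 $\mathfrak b(v_i)$ maximizes over all bids $x\in\mathbb{R}$ the (well-defined) expected utility of agent $i$ when the other agents bid $\mathfrak b(v_j)$. The equilibrium yields the truthful VCG outcome if almost surely every agent is assigned the position $g_i(v)$ that it is assigned under truthful bidding, and if for every agent and every own value $v_i\in[0,\bar v]$ the expected payment given $v_i$ equals that in the $\beta$-VCG mechanism under truthful bidding. If the $\alpha$-VCG mechanism has a Bayes-Nash equilibrium that yields the truthful VCG outcome, then so does the $\alpha$-GFP mechanism. -/

import Mathlib

open MeasureTheory ProbabilityTheory

noncomputable section

namespace PositionAuction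

/-- Vectors of relative values of `k` positions: positive, non-increasing entries. -/
def IsPositionVector {k : ℕ} (β : Fin k → ℝ) : Prop :=
  (∀ j, 0 < β j) ∧ Antitone β

/-- The entry `β_j`, with positions numbered from `0` and the convention `β_j = 0` for `j ≥ k`. -/
def entry {k : ℕ} (β : Fin k → ℝ) (j : ℕ) : ℝ :=
  if h : j < k then β ⟨j, h⟩ else 0

/-- The `j`-th largest entry of `b`, counted from `0` and with multiplicity
(so the largest is `orderStat b 0`), with the convention that it is `0` for `j ≥ n`.
`Tuple.sort b` sorts `b` in ascending order. -/
def orderStat {n : ℕ} (b : Fin n → ℝ) (j : ℕ) : ℝ :=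
  if h : j < n then b (Tuple.sort b (Fin.rev ⟨j, h⟩)) else 0

/-- `g b i` is the position (numbered from `0`) of agent `i` under the bid profile `b`;
agents with `k ≤ g b i` receive nothing. -/
abbrev AllocationRule (n : ℕ) : Type := (Fin n → ℝ) → Equiv.Perm (Fin n)

/-- Positions are assigned in non-increasing order of the bids, with ties broken arbitrarily
(by a fixed rule, since `g` is a function). -/
def IsEfficientRule {n : ℕ} (g : AllocationRule n) : Prop :=
  ∀ (b : Fin n → ℝ) (i j : Fin n), b j < b i → g b i < g b j

/-- A mechanism: an allocation rule and a payment rule, `pay b i` being the payment of agent `i`. -/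
structure Mechanism (n : ℕ) where
  alloc : AllocationRule n
  pay : (Fin n → ℝ) → Fin n → ℝ

/-- The VCG mechanism with parameter `α`: the agent in position `s` pays
`∑_{j ≥ s} (α_j - α_{j+1}) b_{(j+1)}`, the sum being over positions `j`. -/
def vcg {n k : ℕ} (g : AllocationRule n) (α : Fin k → ℝ) : Mechanism n where
  alloc := g
  pay b i := ∑ j ∈ Finset.Ico (g b i : ℕ) k, (entry α j - entry α (j + 1)) * orderStat b (j + 1)

/-- The generalized first-price mechanism with parameter `α`: the agent in position `s` pays
`α_s` times its own bid. -/
def gfp {n k : ℕ} (g : AllocationRule n) (α : Fin k → ℝ) : Mechanism n where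
  alloc := g
  pay b i := entry α (g b i) * b i

/-- The utility of agent `i` with value `x`, when position `j` is worth `β_j x` to it. -/
def utility {n k : ℕ} (M : Mechanism n) (β : Fin k → ℝ) (i : Fin n) (b : Fin n → ℝ) (x : ℝ) : ℝ :=
  entry β (M.alloc b i) * x - M.pay b i

/-- The bid profile in which agent `i` bids `x` and every other agent `j` bids `b (w j)`. -/
def bidProfile {n : ℕ} (b : ℝ → ℝ) (i : Fin n) (x : ℝ) (w : Fin n → ℝ) : Fin n → ℝ :=
  Function.update (fun j => b (w j)) i x

/-- The joint law of `n` independent values with law `μ`. -/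
def valueLaw (n : ℕ) (μ : Measure ℝ) : Measure (Fin n → ℝ) :=
  Measure.pi fun _ => μ

/-- The expected utility of agent `i` with value `v` when it bids `x` and all other agents use the
bidding function `b`. The profile `bidProfile b i x w` does not depend on `w i`, so this is the
expectation over the values of the other agents. -/
def expectedUtility {n k : ℕ} (M : Mechanism n) (β : Fin k → ℝ) (μ : Measure ℝ) (b : ℝ → ℝ)
    (i : Fin n) (x v : ℝ) : ℝ :=
  ∫ w, utility M β i (bidProfile b i x w) v ∂valueLaw n μ

/-- The expected payment of agent `i` when it bids `x` and all other agents use the bidding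
function `b`. -/
def expectedPayment {n : ℕ} (M : Mechanism n) (μ : Measure ℝ) (b : ℝ → ℝ) (i : Fin n) (x : ℝ) : ℝ :=
  ∫ w, M.pay (bidProfile b i x w) i ∂valueLaw n μ

/-- The symmetric profile `(b, …, b)` is a Bayes-Nash equilibrium: expected utilities are
well defined, and for every agent and every value in `[0, vbar]` bidding according to `b` is
optimal among all bids. -/
structure IsBayesNash {n k : ℕ} (M : Mechanism n) (β : Fin k → ℝ) (μ : Measure ℝ) (vbar : ℝ)
    (b : ℝ → ℝ) : Prop where
  measurable : Measurable b
  integrable : ∀ (i : Fin n), ∀ v ∈ Set.Icc 0 vbar, ∀ x : ℝ,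
    Integrable (fun w => utility M β i (bidProfile b i x w) v) (valueLaw n μ)
  optimal : ∀ (i : Fin n), ∀ v ∈ Set.Icc 0 vbar, ∀ x : ℝ,
    expectedUtility M β μ b i x v ≤ expectedUtility M β μ b i (b v) v

/-- When all agents use `b`, the mechanism produces the truthful VCG outcome: almost surely the
positions are those that the VCG mechanism assigns for the true values, and every agent, given
its value, has the same expected payment as in the VCG mechanism (with the true parameter `β`)
under truthful bidding. -/
structure YieldsTruthfulVCG {n k : ℕ} (M : Mechanism n) (g : AllocationRule n) (β : Fin k → ℝ)
    (μ : Measure ℝ) (vbar : ℝ) (b : ℝ → ℝ) : Prop where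
  alloc_eq : ∀ᵐ w ∂valueLaw n μ, M.alloc (fun i => b (w i)) = (vcg g β).alloc w
  pay_eq : ∀ (i : Fin n), ∀ v ∈ Set.Icc 0 vbar,
    expectedPayment M μ b i (b v) = expectedPayment (vcg g β) μ id i v

/-- The mechanism obtains the truthful VCG outcome in a Bayes-Nash equilibrium. -/
def ObtainsTruthfulVCG {n k : ℕ} (M : Mechanism n) (g : AllocationRule n) (β : Fin k → ℝ)
    (μ : Measure ℝ) (vbar : ℝ) : Prop :=
  ∃ b : ℝ → ℝ, IsBayesNash M β μ vbar b ∧ YieldsTruthfulVCG M g β μ vbar b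

/-- The standing assumptions on the law `μ` of a value: it has a density and support `[0, vbar]`,
and the first three derivatives of its distribution function exist and are bounded in the interior
of the support. -/
structure IsValueDistribution (μ : Measure ℝ) (vbar : ℝ) : Prop where
  isProbabilityMeasure : IsProbabilityMeasure μ
  vbar_pos : 0 < vbar
  absolutelyContinuous : μ ≪ volume
  support_eq : μ.support = Set.Icc 0 vbar
  differentiable : ∀ m < 3, DifferentiableOn ℝ (iteratedDeriv m (fun t => cdf μ t)) (Set.Ioo 0 vbar)
  bounded : ∃ C : ℝ, ∀ m ≤ 3, ∀ t ∈ Set.Ioo 0 vbar, |iteratedDeriv m (fun t => cdf μ t) t| ≤ C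

end PositionAuction

end

/-!
Under truthful bidding agent `i` expects an entry of `γ` that increases with its value `v`; let
`λ_γ` be the measure with `λ_γ (-∞, v)` equal to that expectation. When bids are ordered like
values, exchanging the sum over positions for a sum over rivals turns the expected `γ`-VCG payment
of `i` into `∫_{t < v} b(t) dλ_γ(t)`. So if `α`-VCG yields the truthful outcome with the bidding
function `b`, then `∫_{t < v} b(t) dλ_α(t) = ∫_{t < v} t dλ_β(t)`, and the bid

  `B(v) = (∫_{t < v} t dλ_β(t)) / λ_α (-∞, v)`

needed for a first-price auction to collect the truthful payments is the `λ_α`-average of `b` over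
the values below `v`. Truthful positions force `b` to be almost everywhere increasing, hence the
average `B` is strictly increasing. Bidding like the type `u` in the `α`-GFP mechanism then yields
an agent with value `v` the expected utility `∫_{t < u} (v - t) dλ_β(t)`, which is largest at
`u = v`.
-/

noncomputable section

namespace PositionAuction

variable {n k : ℕ}

section Entry

variable {γ : Fin k → ℝ}

lemma entry_eq_zero (γ : Fin k → ℝ) {j : ℕ} (h : k ≤ j) : entry γ j = 0 := by
  simp [entry, h.not_gt]

lemma entry_nonneg (hγ : IsPositionVector γ) (j : ℕ) : 0 ≤ entry γ j := by
  unfold entry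
  split_ifs
  exacts [(hγ.1 _).le, le_rfl]

lemma antitone_entry (hγ : IsPositionVector γ) : Antitone (entry γ) := by
  refine antitone_nat_of_succ_le fun j => ?_
  by_cases h : j + 1 < k
  · simpa only [entry, h, Nat.lt_of_succ_lt h, dif_pos] using hγ.2 (Fin.mk_le_mk.2 j.le_succ)
  · simpa only [entry_eq_zero γ (not_lt.1 h)] using entry_nonneg hγ j

lemma entry_zero_pos (hγ : IsPositionVector γ) (hk : 0 < k) : 0 < entry γ 0 := by
  simpa only [entry, hk, dif_pos] using hγ.1 _

end Entry

section Position

variable {g : AllocationRule n} {p : Fin n → ℝ}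

/-- The number of agents other than `i` whose entry in `w` exceeds `x`: the position, numbered
from `0`, that agent `i` obtains when it bids `x` and its rivals bid as in `w`. -/
def rivalsAbove (i : Fin n) (w : Fin n → ℝ) (x : ℝ) : ℕ :=
  (({i}ᶜ : Finset (Fin n)).filter fun m => x < w m).card

lemma rivalsAbove_update (i : Fin n) (w : Fin n → ℝ) (v x : ℝ) :
    rivalsAbove i (Function.update w i v) x = rivalsAbove i w x := by
  refine congrArg Finset.card (Finset.filter_congr fun m hm => ?_)
  rw [Function.update_of_ne (by simpa using hm)]

lemma rivalsAbove_self_of_lt {i l : Fin n} (h : p l < p i) :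
    rivalsAbove l p (p l) = rivalsAbove i p (p l) + 1 := by
  have hinsert : ({l}ᶜ : Finset (Fin n)).filter (fun m => p l < p m) =
      insert i (({i}ᶜ : Finset (Fin n)).filter fun m => p l < p m) := by
    ext m
    simp only [Finset.mem_filter, Finset.mem_compl, Finset.mem_singleton, Finset.mem_insert]
    grind
  rw [rivalsAbove, hinsert, Finset.card_insert_of_notMem (by simp), rivalsAbove]

lemma exists_isEfficientRule (n : ℕ) : ∃ g : AllocationRule n, IsEfficientRule g := by
  refine ⟨fun b => (Tuple.sort b).symm.trans Fin.revPerm, fun b i j hij => ?_⟩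
  rw [Equiv.trans_apply, Equiv.trans_apply, Fin.revPerm_apply, Fin.revPerm_apply, Fin.rev_lt_rev]
  by_contra! hle
  exact hij.not_ge (by simpa using Tuple.monotone_sort b hle)

namespace IsEfficientRule

lemma lt_iff_lt (hg : IsEfficientRule g) (hp : Function.Injective p) {i j : Fin n} :
    g p i < g p j ↔ p j < p i := by
  refine ⟨fun h => ?_, hg p i j⟩
  rcases lt_trichotomy (p j) (p i) with hlt | heq | hgt
  · exact hlt
  · exact absurd h (by simp [hp heq])
  · exact absurd h (hg p j i hgt).asymm

lemma position_eq (hg : IsEfficientRule g) {i : Fin n} (h : ∀ m ≠ i, p m ≠ p i) :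
    (g p i : ℕ) = rivalsAbove i p (p i) := by
  have habove : ({i}ᶜ : Finset (Fin n)).filter (fun m => p i < p m) =
      (Finset.Iio (g p i)).map (g p).symm.toEmbedding := by
    ext m
    have hback : m ≠ i → g p m < g p i → p i < p m := fun hne hm =>
      lt_of_le_of_ne (not_lt.1 fun hlt => hm.asymm (hg p i m hlt)) (h m hne).symm
    have hforth := hg p m i
    simp only [Finset.mem_filter, Finset.mem_compl, Finset.mem_singleton, Finset.mem_map_equiv,
      Equiv.symm_symm, Finset.mem_Iio]
    grind
  rw [rivalsAbove, habove, Finset.card_map, Fin.card_Iio]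

lemma orderStat_position (hg : IsEfficientRule g) (p : Fin n → ℝ) (i : Fin n) :
    orderStat p (g p i) = p i := by
  have hanti : Monotone (p ∘ (Fin.revPerm.trans (g p).symm)) := by
    intro s t hst
    by_contra! hlt
    have := hg p _ _ hlt
    simp only [Equiv.trans_apply, Fin.revPerm_apply, Equiv.apply_symm_apply,
      Fin.rev_lt_rev] at this
    exact this.not_ge hst
  have hsort := congrFun (Tuple.comp_sort_eq_comp_iff_monotone.2 hanti) (Fin.rev (g p i))
  simpa [orderStat] using hsort.symm

end IsEfficientRule

end Position

section RivalSum

variable {γ : Fin k → ℝ} {i : Fin n} {w : Fin n → ℝ}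

/-- The drop of `γ` from the position of agent `l` in the auction without agent `i` to the next
one: what agent `i` loses when `l` overtakes it. -/
def rivalWeight (γ : Fin k → ℝ) (i : Fin n) (w : Fin n → ℝ) (l : Fin n) : ℝ :=
  entry γ (rivalsAbove i w (w l)) - entry γ (rivalsAbove i w (w l) + 1)

/-- The sum of `φ` over the values of the rivals of agent `i`, weighted by `rivalWeight`. -/
def rivalSum (γ : Fin k → ℝ) (i : Fin n) (φ : ℝ → ℝ) (w : Fin n → ℝ) : ℝ :=
  ∑ l ∈ {i}ᶜ, rivalWeight γ i w l * φ (w l)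

lemma rivalWeight_nonneg (hγ : IsPositionVector γ) (i : Fin n) (w : Fin n → ℝ) (l : Fin n) :
    0 ≤ rivalWeight γ i w l :=
  sub_nonneg.2 (antitone_entry hγ (Nat.le_succ _))

lemma rivalWeight_le (hγ : IsPositionVector γ) (i : Fin n) (w : Fin n → ℝ) (l : Fin n) :
    rivalWeight γ i w l ≤ entry γ 0 :=
  (sub_le_self _ (entry_nonneg hγ _)).trans (antitone_entry hγ (Nat.zero_le _))

lemma rivalSum_update (γ : Fin k → ℝ) (i : Fin n) (φ : ℝ → ℝ) (w : Fin n → ℝ) (v : ℝ) :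
    rivalSum γ i φ (Function.update w i v) = rivalSum γ i φ w := by
  refine Finset.sum_congr rfl fun l hl => ?_
  rw [rivalWeight, Function.update_of_ne (by simpa using hl), rivalsAbove_update, rivalWeight]

lemma sum_positions_below (hkn : k < n) (γ : Fin k → ℝ) (s : Fin n) (f : ℕ → ℝ) :
    ∑ j ∈ Finset.Ico (s : ℕ) k, (entry γ j - entry γ (j + 1)) * f (j + 1) =
      ∑ t ∈ Finset.Ioi s, (entry γ (t - 1) - entry γ t) * f t := by
  have hshift : ∑ t ∈ Finset.Ioi s, (entry γ (t - 1) - entry γ t) * f t =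
      ∑ j ∈ Finset.Ico (s : ℕ) (n - 1), (entry γ j - entry γ (j + 1)) * f (j + 1) := by
    have hval := Finset.sum_map (Finset.Ioi s) Fin.valEmbedding
      fun t => (entry γ (t - 1) - entry γ t) * f t
    rw [Fin.map_valEmbedding_Ioi] at hval
    refine hval.symm.trans (Finset.sum_bij' (fun t _ => t - 1) (fun j _ => j + 1)
      ?_ ?_ ?_ ?_ ?_) <;>
      simp only [Finset.mem_Ico, Finset.mem_Ioo, Nat.add_sub_cancel] <;> grind
  rw [hshift]
  refine Finset.sum_subset (Finset.Ico_subset_Ico_right (by omega)) fun j _ hj => ?_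
  have hkj : k ≤ j := by grind
  rw [entry_eq_zero γ hkj, entry_eq_zero γ (hkj.trans j.le_succ), sub_self, zero_mul]

lemma IsEfficientRule.sum_positions_below_eq_rivalSum {g : AllocationRule n}
    (hg : IsEfficientRule g) (hkn : k < n) (γ : Fin k → ℝ) {p : Fin n → ℝ}
    (hp : Function.Injective p) (i : Fin n) (φ : ℝ → ℝ) :
    ∑ j ∈ Finset.Ico (g p i : ℕ) k, (entry γ j - entry γ (j + 1)) * φ (orderStat p (j + 1)) =
      rivalSum γ i ((Set.Iio (p i)).indicator φ) p := by
  have hposition (l : Fin n) : (g p l : ℕ) = rivalsAbove l p (p l) :=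
    hg.position_eq fun m hm => hp.ne hm
  have hbelow : rivalSum γ i ((Set.Iio (p i)).indicator φ) p =
      ∑ l with p l < p i, rivalWeight γ i p l * φ (p l) := by
    simp only [rivalSum, Set.indicator_apply, Set.mem_Iio, mul_ite, mul_zero, Finset.sum_ite,
      Finset.sum_const_zero, add_zero]
    refine Finset.sum_congr ?_ fun _ _ => rfl
    ext l
    have hne : p l < p i → l ≠ i := by rintro h rfl; exact h.false
    simpa using hne
  rw [sum_positions_below hkn γ (g p i) fun j => φ (orderStat p j), hbelow]
  refine (Finset.sum_equiv (g p) (fun l => ?_) fun l hl => ?_).symm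
  · simp [hg.lt_iff_lt hp]
  · simp only [Finset.mem_filter, Finset.mem_univ, true_and] at hl
    rw [hg.orderStat_position, hposition l, rivalsAbove_self_of_lt hl, rivalWeight,
      Nat.add_sub_cancel]

lemma IsEfficientRule.vcg_pay_eq_rivalSum {g : AllocationRule n} (hg : IsEfficientRule g)
    (hkn : k < n) (γ : Fin k → ℝ) {p : Fin n → ℝ} (hp : Function.Injective p) (i : Fin n) :
    (vcg g γ).pay p i = rivalSum γ i ((Set.Iio (p i)).indicator id) p :=
  hg.sum_positions_below_eq_rivalSum hkn γ hp i id

lemma rivalSum_indicator_one (hkn : k < n) (γ : Fin k → ℝ) {v : ℝ}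
    (hw : Function.Injective (Function.update w i v)) :
    rivalSum γ i ((Set.Iio v).indicator 1) w = entry γ (rivalsAbove i w v) := by
  obtain ⟨g, hg⟩ := exists_isEfficientRule n
  have hsum := hg.sum_positions_below_eq_rivalSum hkn γ hw i 1
  have hposition := hg.position_eq fun m (hm : m ≠ i) => hw.ne hm
  rw [Function.update_self, rivalsAbove_update] at hposition
  rw [Function.update_self, rivalSum_update] at hsum
  simp only [← hsum, Pi.one_apply, mul_one, ← hposition]
  rcases le_total (g (Function.update w i v) i : ℕ) k with hle | hle
  · rw [Finset.sum_Ico_eq_sub _ hle, Finset.sum_range_sub', Finset.sum_range_sub',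
      entry_eq_zero γ le_rfl]
    ring
  · rw [Finset.Ico_eq_empty_of_le hle, Finset.sum_empty, entry_eq_zero γ hle]

end RivalSum

section BidProfile

variable {b : ℝ → ℝ} {i : Fin n} {v : ℝ} {w : Fin n → ℝ}

lemma rivalsAbove_comp (hb : StrictMonoOn b (Set.range w)) (i l : Fin n) :
    rivalsAbove i (b ∘ w) (b (w l)) = rivalsAbove i w (w l) := by
  simp only [rivalsAbove, Function.comp_apply,
    hb.lt_iff_lt (Set.mem_range_self _) (Set.mem_range_self _)]

lemma rivalSum_comp (hb : StrictMonoOn b (Set.range w)) (γ : Fin k → ℝ) (i : Fin n)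
    (φ : ℝ → ℝ) : rivalSum γ i φ (b ∘ w) = rivalSum γ i (φ ∘ b) w := by
  simp only [rivalSum, rivalWeight, Function.comp_apply, rivalsAbove_comp hb]

lemma IsEfficientRule.comp_eq {g : AllocationRule n} (hg : IsEfficientRule g)
    (hw : Function.Injective w) (hb : StrictMonoOn b (Set.range w)) :
    g (b ∘ w) = g w := by
  have hbw : Function.Injective (b ∘ w) := fun l m h =>
    hw (hb.injOn (Set.mem_range_self _) (Set.mem_range_self _) h)
  refine Equiv.ext fun i => Fin.ext ?_
  rw [hg.position_eq fun m hm => hbw.ne hm, hg.position_eq fun m hm => hw.ne hm,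
    Function.comp_apply, rivalsAbove_comp hb]

lemma bidProfile_self (b : ℝ → ℝ) (i : Fin n) (x : ℝ) (w : Fin n → ℝ) :
    bidProfile b i x w i = x := by
  rw [bidProfile, Function.update_self]

lemma bidProfile_eq_comp_update (b : ℝ → ℝ) (i : Fin n) (v : ℝ) (w : Fin n → ℝ) :
    bidProfile b i (b v) w = b ∘ Function.update w i v :=
  (Function.comp_update b w i v).symm

lemma injective_bidProfile (hw : Function.Injective (Function.update w i v))
    (hb : StrictMonoOn b (Set.range (Function.update w i v))) :
    Function.Injective (bidProfile b i (b v) w) := by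
  rw [bidProfile_eq_comp_update]
  exact fun l m h => hw (hb.injOn (Set.mem_range_self _) (Set.mem_range_self _) h)

lemma IsEfficientRule.vcg_pay_bidProfile {g : AllocationRule n} (hg : IsEfficientRule g)
    (hkn : k < n) (γ : Fin k → ℝ) (hw : Function.Injective (Function.update w i v))
    (hb : StrictMonoOn b (Set.range (Function.update w i v))) :
    (vcg g γ).pay (bidProfile b i (b v) w) i = rivalSum γ i ((Set.Iio v).indicator b) w := by
  rw [hg.vcg_pay_eq_rivalSum hkn γ (injective_bidProfile hw hb), bidProfile_eq_comp_update,
    rivalSum_comp hb, ← rivalSum_update γ i _ w v]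
  refine Finset.sum_congr rfl fun l _ => ?_
  have hlt := hb.lt_iff_lt (Set.mem_range_self l) (Set.mem_range_self i)
  simp only [Function.update_self] at hlt
  simp only [Function.comp_apply, Function.update_self, Set.indicator_apply, Set.mem_Iio, hlt, id]

end BidProfile

/-- The bid `x` ranks as the value `u` against rivals whose values have law `μ` and who bid by the
bidding function `b`: almost surely it beats the rivals with values below `u`, and loses against
those with values above `u`. -/
def RanksAs (μ : Measure ℝ) (b : ℝ → ℝ) (x u : ℝ) : Prop :=
  ∀ᵐ t ∂μ, (t < u → b t < x) ∧ (u < t → x < b t)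

section ValueLaw

variable {μ : Measure ℝ} [IsProbabilityMeasure μ]

instance : IsProbabilityMeasure (valueLaw n μ) := by
  unfold valueLaw
  infer_instance

lemma ae_valueLaw_of_ae {P : ℝ → Prop} (h : ∀ᵐ t ∂μ, P t) :
    ∀ᵐ w ∂valueLaw n μ, ∀ l, P (w l) :=
  Filter.eventually_all.2 fun _ => Measure.tendsto_eval_ae_ae.eventually h

lemma measurePreserving_comp_perm (σ : Equiv.Perm (Fin n)) :
    MeasurePreserving (fun w : Fin n → ℝ => w ∘ σ) (valueLaw n μ) (valueLaw n μ) := by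
  unfold valueLaw
  convert measurePreserving_piCongrLeft (fun _ : Fin n => μ) σ.symm using 1
  ext w j
  obtain ⟨j, rfl⟩ := σ.symm.surjective j
  rw [MeasurableEquiv.coe_piCongrLeft, Equiv.piCongrLeft_apply_apply]
  simp

lemma measurePreserving_eval_pair {l m : Fin n} (hlm : l ≠ m) :
    MeasurePreserving (fun w : Fin n → ℝ => (w l, w m)) (valueLaw n μ) (μ.prod μ) := by
  have heval (j : Fin n) : MeasurePreserving (fun w : Fin n → ℝ => w j) (valueLaw n μ) μ :=
    measurePreserving_eval (fun _ : Fin n => μ) j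
  have hind : IndepFun (fun w : Fin n → ℝ => w l) (fun w => w m) (valueLaw n μ) :=
    (iIndepFun_pi (μ := fun _ : Fin n => μ) (X := fun _ t => t)
      fun _ => aemeasurable_id).indepFun hlm
  rw [indepFun_iff_map_prod_eq_prod_map_map (heval l).measurable.aemeasurable
    (heval m).measurable.aemeasurable, (heval l).map_eq, (heval m).map_eq] at hind
  exact ⟨(heval l).measurable.prodMk (heval m).measurable, hind⟩

section NullSingletonClass

variable [NullSingletonClass μ]

lemma ae_injective : ∀ᵐ w ∂valueLaw n μ, Function.Injective w := by
  have hdiagonal : ∀ᵐ q ∂μ.prod μ, q.1 ≠ q.2 := by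
    refine (Measure.ae_prod_iff_ae_ae ?_).2 (Filter.Eventually.of_forall fun s => ?_)
    · exact (measurableSet_eq_fun measurable_fst measurable_snd).compl
    · simpa only [ne_comm] using Measure.ae_ne μ s
  have hne (l m : Fin n) : ∀ᵐ w ∂valueLaw n μ, l ≠ m → w l ≠ w m := by
    by_cases hlm : l = m
    · simp [hlm]
    · filter_upwards [(measurePreserving_eval_pair hlm).quasiMeasurePreserving.ae hdiagonal]
        with w hw _ using hw
  filter_upwards [ae_all_iff.2 fun l => ae_all_iff.2 (hne l)] with w hw l m
  exact not_imp_not.1 (hw l m)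

lemma ae_injective_update (i : Fin n) (v : ℝ) :
    ∀ᵐ w ∂valueLaw n μ, Function.Injective (Function.update w i v) := by
  filter_upwards [ae_valueLaw_of_ae (Measure.ae_ne μ v), ae_injective] with w hv hw l m hlm
  have := @hw l m
  grind [Function.update_apply]

end NullSingletonClass

section TruthfulAllocation

variable {g : AllocationRule n} {b : ℝ → ℝ}

lemma ae_bid_lt_bid (hg : IsEfficientRule g)
    (halloc : ∀ᵐ w ∂valueLaw n μ, g (fun i => b (w i)) = g w) (l m : Fin n) :
    ∀ᵐ w ∂valueLaw n μ, w l < w m → b (w l) < b (w m) := by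
  have hswap := (measurePreserving_comp_perm (μ := μ) (Equiv.swap l m)).quasiMeasurePreserving.ae
    halloc
  filter_upwards [halloc, hswap] with w hw hw' hlt
  have hposition : g w m < g w l := hg w m l hlt
  rcases lt_trichotomy (b (w l)) (b (w m)) with hbid | hbid | hbid
  · exact hbid
  · have hsame : (fun i => b ((w ∘ Equiv.swap l m) i)) = fun i => b (w i) := by
      funext i
      simp only [Function.comp_apply, Equiv.swap_apply_def]
      grind
    have hposition' : g (w ∘ Equiv.swap l m) l < g (w ∘ Equiv.swap l m) m :=
      hg _ l m (by simpa using hlt)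
    rw [← hw', hsame, hw] at hposition'
    exact absurd hposition' hposition.asymm
  · have hposition' := hg (fun i => b (w i)) l m hbid
    rw [hw] at hposition'
    exact absurd hposition' hposition.asymm

lemma ae_ranksAs (hn : 2 ≤ n) (hg : IsEfficientRule g) (hb : Measurable b)
    (halloc : ∀ᵐ w ∂valueLaw n μ, g (fun i => b (w i)) = g w) :
    ∀ᵐ v ∂μ, RanksAs μ b (b v) v := by
  let l : Fin n := ⟨0, by omega⟩
  let m : Fin n := ⟨1, by omega⟩
  have hlm : l ≠ m := by simp [l, m]
  refine Measure.ae_ae_of_ae_prod (p := fun q : ℝ × ℝ =>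
    (q.2 < q.1 → b q.2 < b q.1) ∧ (q.1 < q.2 → b q.1 < b q.2)) ?_
  rw [← (measurePreserving_eval_pair (μ := μ) hlm).map_eq,
    ae_map_iff (measurePreserving_eval_pair (μ := μ) hlm).measurable.aemeasurable]
  · filter_upwards [ae_bid_lt_bid hg halloc l m, ae_bid_lt_bid hg halloc m l] with w h h'
    exact ⟨h', h⟩
  · simp only [imp_iff_not_or, not_lt]
    exact ((measurableSet_le measurable_fst measurable_snd).union
      (measurableSet_lt (hb.comp measurable_snd) (hb.comp measurable_fst))).inter
      ((measurableSet_le measurable_snd measurable_fst).union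
        (measurableSet_lt (hb.comp measurable_fst) (hb.comp measurable_snd)))

lemma ae_strictMonoOn_range_update (hg : IsEfficientRule g)
    (halloc : ∀ᵐ w ∂valueLaw n μ, g (fun i => b (w i)) = g w) (i : Fin n) {v : ℝ}
    (hv : RanksAs μ b (b v) v) :
    ∀ᵐ w ∂valueLaw n μ, StrictMonoOn b (Set.range (Function.update w i v)) := by
  filter_upwards [ae_valueLaw_of_ae hv,
    ae_all_iff.2 fun l => ae_all_iff.2 (ae_bid_lt_bid hg halloc l)] with w hw hlt
  rintro _ ⟨l, rfl⟩ _ ⟨m, rfl⟩ hlm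
  have := hlt l m
  grind [Function.update_apply]

end TruthfulAllocation

end ValueLaw

section AllocationMeasure

lemma measurable_rivalsAbove (i : Fin n) {f : (Fin n → ℝ) → ℝ} (hf : Measurable f) :
    Measurable fun w : Fin n → ℝ => rivalsAbove i w (f w) := by
  unfold rivalsAbove
  simp only [Finset.card_filter]
  exact Finset.measurable_sum _ fun m _ =>
    Measurable.ite (measurableSet_lt hf (measurable_pi_apply m)) measurable_const measurable_const

lemma measurable_rivalWeight (γ : Fin k → ℝ) (i l : Fin n) :
    Measurable fun w => rivalWeight γ i w l :=
  (measurable_from_top (f := fun j : ℕ => entry γ j - entry γ (j + 1))).comp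
    (measurable_rivalsAbove i (measurable_pi_apply l))

lemma measurable_ofReal_rivalWeight_mul (γ : Fin k → ℝ) (i l : Fin n) {f : ℝ → ENNReal}
    (hf : Measurable f) : Measurable fun w => ENNReal.ofReal (rivalWeight γ i w l) * f (w l) :=
  (measurable_rivalWeight γ i l).ennreal_ofReal.mul (hf.comp (measurable_pi_apply l))

/-- The law of the value of a rival of agent `i`, each rival being weighted by `rivalWeight`. The
mass it gives to `(-∞, v)` is the expected entry of `γ` that agent `i` obtains with the value `v`
when every agent bids truthfully. -/
def allocationMeasure (μ : Measure ℝ) (γ : Fin k → ℝ) (i : Fin n) : Measure ℝ :=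
  ∑ l ∈ {i}ᶜ, ((valueLaw n μ).withDensity fun w => ENNReal.ofReal (rivalWeight γ i w l)).map
    fun w => w l

lemma rivalsAbove_comp_perm (σ : Equiv.Perm (Fin n)) (i : Fin n) (w : Fin n → ℝ) (x : ℝ) :
    rivalsAbove i (w ∘ σ) x = rivalsAbove (σ i) w x := by
  refine Finset.card_equiv σ fun m => ?_
  simp

lemma rivalWeight_comp_perm (σ : Equiv.Perm (Fin n)) (γ : Fin k → ℝ) (i : Fin n)
    (w : Fin n → ℝ) (l : Fin n) :
    rivalWeight γ i (w ∘ σ) l = rivalWeight γ (σ i) w (σ l) := by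
  simp only [rivalWeight, rivalsAbove_comp_perm, Function.comp_apply]

variable {μ : Measure ℝ} {γ : Fin k → ℝ}

lemma lintegral_allocationMeasure (γ : Fin k → ℝ) (i : Fin n) {f : ℝ → ENNReal}
    (hf : Measurable f) :
    ∫⁻ t, f t ∂allocationMeasure μ γ i =
      ∫⁻ w, ∑ l ∈ {i}ᶜ, ENNReal.ofReal (rivalWeight γ i w l) * f (w l) ∂valueLaw n μ := by
  rw [allocationMeasure, lintegral_finsetSum_measure,
    lintegral_finsetSum _ fun l _ => measurable_ofReal_rivalWeight_mul γ i l hf]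
  refine Finset.sum_congr rfl fun l _ => ?_
  have hfl : Measurable fun w : Fin n → ℝ => f (w l) := hf.comp (measurable_pi_apply l)
  rw [lintegral_map hf (measurable_pi_apply l),
    lintegral_withDensity_eq_lintegral_mul _ (measurable_rivalWeight γ i l).ennreal_ofReal hfl]
  rfl

lemma integrable_allocationMeasure_iff (hγ : IsPositionVector γ) (i : Fin n) {φ : ℝ → ℝ}
    (hφ : Measurable φ) : Integrable φ (allocationMeasure μ γ i) ↔
      ∀ l ∈ ({i}ᶜ : Finset (Fin n)),
        Integrable (fun w => rivalWeight γ i w l * φ (w l)) (valueLaw n μ) := by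
  rw [allocationMeasure, integrable_finsetSum_measure]
  refine forall₂_congr fun l _ => ?_
  rw [integrable_map_measure hφ.aestronglyMeasurable (measurable_pi_apply l).aemeasurable,
    integrable_withDensity_iff_integrable_smul' (measurable_rivalWeight γ i l).ennreal_ofReal
      (Filter.Eventually.of_forall fun _ => ENNReal.ofReal_lt_top)]
  simp only [ENNReal.toReal_ofReal (rivalWeight_nonneg hγ i _ l), smul_eq_mul, Function.comp_apply]

lemma integrable_rivalSum (hγ : IsPositionVector γ) {i : Fin n} {φ : ℝ → ℝ} (hφ : Measurable φ)
    (hint : Integrable φ (allocationMeasure μ γ i)) :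
    Integrable (rivalSum γ i φ) (valueLaw n μ) :=
  integrable_finsetSum _ ((integrable_allocationMeasure_iff hγ i hφ).1 hint)

lemma integral_rivalSum (hγ : IsPositionVector γ) {i : Fin n} {φ : ℝ → ℝ} (hφ : Measurable φ)
    (hint : Integrable φ (allocationMeasure μ γ i)) :
    ∫ w, rivalSum γ i φ w ∂valueLaw n μ = ∫ t, φ t ∂allocationMeasure μ γ i := by
  have hterm := (integrable_allocationMeasure_iff hγ i hφ).1 hint
  simp only [rivalSum]
  rw [integral_finsetSum _ hterm, allocationMeasure,
    integral_finsetSum_measure (integrable_finsetSum_measure.1 hint)]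
  refine Finset.sum_congr rfl fun l _ => ?_
  rw [integral_map (measurable_pi_apply l).aemeasurable hφ.aestronglyMeasurable,
    integral_withDensity_eq_integral_toReal_smul (measurable_rivalWeight γ i l).ennreal_ofReal
      (Filter.Eventually.of_forall fun _ => ENNReal.ofReal_lt_top)]
  simp only [ENNReal.toReal_ofReal (rivalWeight_nonneg hγ i _ l), smul_eq_mul]

variable [IsProbabilityMeasure μ]

lemma allocationMeasure_eq (γ : Fin k → ℝ) (i j : Fin n) :
    allocationMeasure μ γ i = allocationMeasure μ γ j := by
  refine Measure.ext_of_lintegral _ fun f hf => ?_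
  let σ := Equiv.swap i j
  have hσ : MeasurePreserving (fun w : Fin n → ℝ => w ∘ σ) (valueLaw n μ) (valueLaw n μ) :=
    measurePreserving_comp_perm σ
  rw [lintegral_allocationMeasure γ i hf, lintegral_allocationMeasure γ j hf, ← hσ.lintegral_comp]
  · refine lintegral_congr fun w => Finset.sum_equiv σ (fun l => ?_) fun l _ => ?_
    · simp [σ, Equiv.swap_apply_eq_iff]
    · rw [rivalWeight_comp_perm, Equiv.swap_apply_left, Function.comp_apply]
  · exact Finset.measurable_sum _ fun l _ =>
      measurable_ofReal_rivalWeight_mul γ i l hf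

lemma allocationMeasure_absolutelyContinuous (γ : Fin k → ℝ) (i : Fin n) :
    allocationMeasure μ γ i ≪ μ := by
  unfold allocationMeasure
  refine Measure.AbsolutelyContinuous.mk fun s hs hμs => ?_
  rw [Measure.finsetSum_apply]
  refine Finset.sum_eq_zero fun l _ => ?_
  rw [Measure.map_apply (measurable_pi_apply l) hs]
  exact withDensity_absolutelyContinuous _ _
    ((measurePreserving_eval (fun _ : Fin n => μ) l).quasiMeasurePreserving.preimage_null hμs)

lemma isFiniteMeasure_allocationMeasure (hγ : IsPositionVector γ) (i : Fin n) :
    IsFiniteMeasure (allocationMeasure μ γ i) := by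
  have hfinite (l : Fin n) : IsFiniteMeasure
      ((valueLaw n μ).withDensity fun w => ENNReal.ofReal (rivalWeight γ i w l)) := by
    refine isFiniteMeasure_withDensity_ofReal (HasFiniteIntegral.of_bounded (C := entry γ 0) ?_)
    refine Filter.Eventually.of_forall fun w => ?_
    simpa only [Real.norm_of_nonneg (rivalWeight_nonneg hγ i w l)] using rivalWeight_le hγ i w l
  unfold allocationMeasure
  infer_instance

lemma sum_rivalWeight (hkn : k < n) (γ : Fin k → ℝ) (i : Fin n) {w : Fin n → ℝ}
    (hw : Function.Injective w) : ∑ l ∈ {i}ᶜ, rivalWeight γ i w l = entry γ 0 := by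
  obtain ⟨v, hv⟩ := (Set.finite_range w).bddAbove
  have hlt (l : Fin n) : w l < v + 1 := by
    linarith [hv (Set.mem_range_self l)]
  have hinj : Function.Injective (Function.update w i (v + 1)) := by
    intro l m
    have := @hw l m
    grind [Function.update_apply]
  have hbottom : rivalsAbove i w (v + 1) = 0 := by
    simp [rivalsAbove, Finset.filter_false_of_mem fun m _ => (hlt m).not_gt]
  rw [← hbottom, ← rivalSum_indicator_one hkn γ hinj]
  simp [rivalSum, hlt]

lemma absolutelyContinuous_allocationMeasure [NullSingletonClass μ] (hkn : k < n) (hk : 0 < k)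
    (hγ : IsPositionVector γ) (i : Fin n) : μ ≪ allocationMeasure μ γ i := by
  refine Measure.AbsolutelyContinuous.mk fun s hs hzero => ?_
  have hbox : valueLaw n μ (Set.univ.pi fun _ => s) = 0 := by
    rw [← lintegral_indicator_one hs,
      lintegral_allocationMeasure γ i (measurable_one.indicator hs), lintegral_eq_zero_iff] at hzero
    · rw [measure_eq_zero_iff_ae_notMem]
      filter_upwards [hzero, ae_injective] with w hw hinj hmem
      refine (entry_zero_pos hγ hk).not_ge ?_
      rw [← sum_rivalWeight hkn γ i hinj]
      refine Finset.sum_nonpos fun l hl => ENNReal.ofReal_eq_zero.1 ?_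
      simpa [hmem l (Set.mem_univ l)] using Finset.sum_eq_zero_iff.1 hw l hl
    · exact Finset.measurable_sum _ fun l _ =>
        measurable_ofReal_rivalWeight_mul γ i l (measurable_one.indicator hs)
  rw [valueLaw, Measure.pi_pi, Finset.prod_const] at hbox
  exact eq_zero_of_pow_eq_zero hbox

lemma integrable_of_integrable_rivalSum (hγ : IsPositionVector γ) {i : Fin n} {φ : ℝ → ℝ}
    (hφ : Measurable φ) (hnonneg : 0 ≤ᵐ[μ] φ) (hint : Integrable (rivalSum γ i φ) (valueLaw n μ)) :
    Integrable φ (allocationMeasure μ γ i) := by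
  refine (integrable_allocationMeasure_iff hγ i hφ).2 fun l hl => hint.mono'
    ((measurable_rivalWeight γ i l).mul
      (hφ.comp (measurable_pi_apply l))).aestronglyMeasurable ?_
  filter_upwards [ae_valueLaw_of_ae hnonneg] with w hw
  have hterm (m : Fin n) : 0 ≤ rivalWeight γ i w m * φ (w m) :=
    mul_nonneg (rivalWeight_nonneg hγ i w m) (hw m)
  rw [Real.norm_of_nonneg (hterm l)]
  exact Finset.single_le_sum (fun m _ => hterm m) hl

lemma integral_entry_rivalsAbove [NullSingletonClass μ] (hkn : k < n) (hγ : IsPositionVector γ)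
    (i : Fin n) (v : ℝ) : ∫ w, entry γ (rivalsAbove i w v) ∂valueLaw n μ =
      (allocationMeasure μ γ i).real (Set.Iio v) := by
  have := isFiniteMeasure_allocationMeasure (μ := μ) hγ i
  have hint : Integrable ((Set.Iio v).indicator (1 : ℝ → ℝ)) (allocationMeasure μ γ i) :=
    (integrable_const 1).indicator measurableSet_Iio
  rw [← integral_indicator_one measurableSet_Iio,
    ← integral_rivalSum hγ (measurable_one.indicator measurableSet_Iio) hint]
  refine integral_congr_ae ?_
  filter_upwards [ae_injective_update i v] with w hw
  exact (rivalSum_indicator_one hkn γ hw).symm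

end AllocationMeasure

section SetAverage

variable {X : Type*} [MeasurableSpace X] {ν : Measure X} {φ : X → ℝ} {s : Set X} {c : ℝ}

lemma setAverage_lt_of_ae_lt (h₀ : ν s ≠ 0) (h₁ : ν s ≠ ⊤) (hφ : IntegrableOn φ s ν)
    (h : ∀ᵐ t ∂ν, t ∈ s → φ t < c) : ⨍ t in s, φ t ∂ν < c := by
  by_contra! hc
  refine (measure_setAverage_le_pos h₀ h₁ hφ).ne' (measure_eq_zero_iff_ae_notMem.2 ?_)
  filter_upwards [h] with t ht hmem using ((ht hmem.1).trans_le hc).not_ge hmem.2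

lemma lt_setAverage_of_ae_lt (h₀ : ν s ≠ 0) (h₁ : ν s ≠ ⊤) (hφ : IntegrableOn φ s ν)
    (h : ∀ᵐ t ∂ν, t ∈ s → c < φ t) : c < ⨍ t in s, φ t ∂ν := by
  by_contra! hc
  refine (measure_le_setAverage_pos h₀ h₁ hφ).ne' (measure_eq_zero_iff_ae_notMem.2 ?_)
  filter_upwards [h] with t ht hmem using (hc.trans_lt (ht hmem.1)).not_ge hmem.2

end SetAverage

section RealMeasure

variable {ν : Measure ℝ}

lemma continuous_setIntegral_Iio [NullSingletonClass ν] {φ : ℝ → ℝ}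
    (hφ : Integrable φ ν) : Continuous fun v => ∫ t in Set.Iio v, φ t ∂ν :=
  continuous_iff_continuousAt.2 fun v => hφ.integrableOn.continuousOn_Iic_primitive_Iio.continuousAt
    (Iic_mem_nhds (lt_add_one v))

variable [IsFiniteMeasure ν]

lemma setAverage_Iio_lt_setAverage_Iio [NullSingletonClass ν] {φ : ℝ → ℝ} {x y c : ℝ}
    (hxy : x < y) (hx : ν (Set.Iio x) ≠ 0) (hIoo : ν (Set.Ioo x y) ≠ 0)
    (hφ : IntegrableOn φ (Set.Iio y) ν)
    (hlt : RanksAs ν φ c x) :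
    ⨍ t in Set.Iio x, φ t ∂ν < ⨍ t in Set.Iio y, φ t ∂ν := by
  have hIco : ν (Set.Ico x y) ≠ 0 := by rwa [← measure_congr Ioo_ae_eq_Ico]
  have hφx : IntegrableOn φ (Set.Iio x) ν := hφ.mono_set (Set.Iio_subset_Iio hxy.le)
  have hφxy : IntegrableOn φ (Set.Ico x y) ν := hφ.mono_set Set.Ico_subset_Iio_self
  have hbelow : ⨍ t in Set.Iio x, φ t ∂ν < c :=
    setAverage_lt_of_ae_lt hx (measure_ne_top _ _) hφx (hlt.mono fun t ht => ht.1)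
  have habove : c < ⨍ t in Set.Ico x y, φ t ∂ν := by
    refine lt_setAverage_of_ae_lt hIco (measure_ne_top _ _) hφxy ?_
    filter_upwards [hlt, Measure.ae_ne ν x] with t ht hne hmem
    exact ht.2 (hmem.1.lt_of_ne' hne)
  have hmem := average_union_mem_openSegment
    (Set.Iio_disjoint_Ici le_rfl |>.mono_right Set.Ico_subset_Ici_self).aedisjoint
    measurableSet_Ico.nullMeasurableSet hx hIco (measure_ne_top _ _) (measure_ne_top _ _) hφx hφxy
  rw [openSegment_eq_Ioo (hbelow.trans habove), Set.Iio_union_Ico_eq_Iio hxy.le] at hmem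
  exact hmem.1

lemma setIntegral_Iio_sub_le (hν : Integrable id ν) (u v : ℝ) :
    ∫ t in Set.Iio u, (v - t) ∂ν ≤ ∫ t in Set.Iio v, (v - t) ∂ν := by
  have hint : Integrable (fun t => v - t) ν := (integrable_const v).sub hν
  rw [← integral_indicator measurableSet_Iio, ← integral_indicator measurableSet_Iio]
  refine integral_mono (hint.indicator measurableSet_Iio) (hint.indicator measurableSet_Iio)
    fun t => ?_
  simp only [Set.indicator_apply, Set.mem_Iio]
  grind

end RealMeasure

lemma strictMonoOn_of_subset_closure {X Y : Type*} [LinearOrder X] [DenselyOrdered X]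
    [TopologicalSpace X] [OrderTopology X] [Preorder Y] [TopologicalSpace Y]
    [OrderClosedTopology Y] {f : X → Y} {s G : Set X} (hs : s.OrdConnected) (hG : s ⊆ closure G)
    (hf : ContinuousOn f s) (hmono : StrictMonoOn f (s ∩ G)) : StrictMonoOn f s := by
  have hclosure {p q : X} (hp : p ∈ s) (hq : q ∈ s) (hpq : p < q) :
      Set.Icc p q ⊆ closure (Set.Ioo p q ∩ G) := by
    rw [← closure_Ioo hpq.ne]
    refine closure_minimal (fun t ht => isOpen_Ioo.inter_closure ⟨ht, ?_⟩) isClosed_closure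
    exact hG (hs.out hp hq (Set.Ioo_subset_Icc_self ht))
  intro x hx y hy hxy
  obtain ⟨p, ⟨hxp, hpy⟩, hpG⟩ : (Set.Ioo x y ∩ G).Nonempty :=
    closure_nonempty_iff.1 ⟨x, hclosure hx hy hxy (Set.left_mem_Icc.2 hxy.le)⟩
  have hp : p ∈ s := hs.out hx hy ⟨hxp.le, hpy.le⟩
  obtain ⟨q, ⟨hpq, hqy⟩, hqG⟩ : (Set.Ioo p y ∩ G).Nonempty :=
    closure_nonempty_iff.1 ⟨p, hclosure hp hy hpy (Set.left_mem_Icc.2 hpy.le)⟩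
  have hq : q ∈ s := hs.out hp hy ⟨hpq.le, hqy.le⟩
  have hmem {p q : X} (hp : p ∈ s) (hq : q ∈ s) : Set.Ioo p q ∩ G ⊆ s := fun t ht =>
    hs.out hp hq (Set.Ioo_subset_Icc_self ht.1)
  have hfx : f x ≤ f p :=
    ((hf x hx).mono (hmem hx hp)).closure_le (hclosure hx hp hxp (Set.left_mem_Icc.2 hxp.le))
      continuousWithinAt_const fun t ht => (hmono ⟨hmem hx hp ht, ht.2⟩ ⟨hp, hpG⟩ ht.1.2).le
  have hfy : f q ≤ f y :=
    continuousWithinAt_const.closure_le (hclosure hq hy hqy (Set.right_mem_Icc.2 hqy.le))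
      ((hf y hy).mono (hmem hq hy)) fun t ht => (hmono ⟨hq, hqG⟩ ⟨hmem hq hy ht, ht.2⟩ ht.1.1).le
  exact hfx.trans_lt ((hmono ⟨hp, hpG⟩ ⟨hq, hqG⟩ hpq).trans_le hfy)

lemma exists_forall_lt_of_strictMonoOn {f : ℝ → ℝ} {a c : ℝ} (hac : a ≤ c)
    (hf : StrictMonoOn f (Set.Icc a c)) (hcont : ContinuousOn f (Set.Ioc a c)) (x : ℝ) :
    ∃ u ∈ Set.Icc a c, (u = a ∨ f u ≤ x) ∧
      ∀ t ∈ Set.Ioo a c, (t < u → f t < x) ∧ (u < t → x < f t) := by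
  have hc : c ∈ Set.Icc a c := Set.right_mem_Icc.2 hac
  rcases le_or_gt (f c) x with hx | hx
  · refine ⟨c, hc, Or.inr hx, fun t ht => ⟨fun htc => ?_, fun hct => absurd ht.2 hct.asymm⟩⟩
    exact (hf (Set.Ioo_subset_Icc_self ht) hc htc).trans_le hx
  by_cases hex : ∃ u ∈ Set.Ioc a c, f u ≤ x
  · obtain ⟨u, hu, hux⟩ := hex
    obtain ⟨s, hs, rfl⟩ := intermediate_value_Icc hu.2
      (hcont.mono fun t ht => ⟨hu.1.trans_le ht.1, ht.2⟩) ⟨hux, hx.le⟩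
    have hs' : s ∈ Set.Icc a c := ⟨hu.1.le.trans hs.1, hs.2⟩
    exact ⟨s, hs', Or.inr le_rfl, fun t ht =>
      ⟨hf (Set.Ioo_subset_Icc_self ht) hs', hf hs' (Set.Ioo_subset_Icc_self ht)⟩⟩
  · push Not at hex
    exact ⟨a, Set.left_mem_Icc.2 hac, Or.inl rfl, fun t ht =>
      ⟨fun hta => absurd ht.1 hta.asymm, fun _ => hex t ⟨ht.1, ht.2.le⟩⟩⟩

section Support

variable {μ : Measure ℝ} {a c : ℝ}

lemma measure_Ioo_pos (hsupp : μ.support = Set.Icc a c) {x y : ℝ} (hx : a ≤ x) (hxy : x < y)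
    (hy : y ≤ c) : 0 < μ (Set.Ioo x y) := by
  obtain ⟨t, hxt, hty⟩ := exists_between hxy
  have ht : t ∈ μ.support := hsupp ▸ ⟨hx.trans hxt.le, hty.le.trans hy⟩
  exact (Measure.mem_support_iff_forall t).1 ht _ (Ioo_mem_nhds hxt hty)

lemma ae_mem_Ioo [NullSingletonClass μ] (hsupp : μ.support = Set.Icc a c) :
    ∀ᵐ t ∂μ, t ∈ Set.Ioo a c := by
  have hIcc : ∀ᵐ t ∂μ, t ∈ Set.Icc a c := hsupp ▸ Measure.support_mem_ae
  filter_upwards [hIcc, Measure.ae_ne μ a, Measure.ae_ne μ c] with t ht ha hc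
  exact ⟨ht.1.lt_of_ne' ha, ht.2.lt_of_ne hc⟩

lemma measure_Iio_pos [NeZero μ] [NullSingletonClass μ] (hsupp : μ.support = Set.Icc a c) {v : ℝ}
    (hv : a < v) : 0 < μ (Set.Iio v) := by
  obtain ⟨t, ht⟩ := (ae_mem_Ioo hsupp).exists
  exact (measure_Ioo_pos hsupp le_rfl (lt_min hv (ht.1.trans ht.2)) (min_le_right v c)).trans_le
    (measure_mono fun _ ht => ht.2.trans_le (min_le_left v c))

lemma ranksAs_of_strictMonoOn [NullSingletonClass μ] (hsupp : μ.support = Set.Icc a c) {b : ℝ → ℝ}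
    (hb : StrictMonoOn b (Set.Icc a c)) {u : ℝ} (hu : u ∈ Set.Icc a c) : RanksAs μ b (b u) u := by
  filter_upwards [ae_mem_Ioo hsupp] with t ht
  exact ⟨hb (Set.Ioo_subset_Icc_self ht) hu, hb hu (Set.Ioo_subset_Icc_self ht)⟩

end Support

section FirstPriceBid

variable {μ : Measure ℝ} {vbar : ℝ} {α β γ : Fin k → ℝ}

/-- The bid of an agent with value `v` for which its expected payment under `gfp`, when every agent
is assigned its truthful position, is its expected payment in the truthful VCG mechanism. It does
not depend on the agent `i`, and it is the junk value `x / 0 = 0` at `v = 0`. -/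
def firstPriceBid (μ : Measure ℝ) (α β : Fin k → ℝ) (i : Fin n) (v : ℝ) : ℝ :=
  (∫ t in Set.Iio v, t ∂allocationMeasure μ β i) / (allocationMeasure μ α i).real (Set.Iio v)

lemma firstPriceBid_eq_setAverage {i : Fin n} {b : ℝ → ℝ} {v : ℝ}
    (heq : ∫ t in Set.Iio v, b t ∂allocationMeasure μ α i =
      ∫ t in Set.Iio v, t ∂allocationMeasure μ β i) :
    firstPriceBid μ α β i v = ⨍ t in Set.Iio v, b t ∂allocationMeasure μ α i := by
  rw [firstPriceBid, setAverage_eq, ← heq, smul_eq_mul, div_eq_inv_mul]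

variable [IsProbabilityMeasure μ]

lemma firstPriceBid_eq (α β : Fin k → ℝ) (i j : Fin n) :
    firstPriceBid μ α β i = firstPriceBid μ α β j := by
  unfold firstPriceBid
  rw [allocationMeasure_eq α i j, allocationMeasure_eq β i j]

variable [NullSingletonClass μ]

instance (γ : Fin k → ℝ) (i : Fin n) : NullSingletonClass (allocationMeasure μ γ i) :=
  ⟨fun t => allocationMeasure_absolutelyContinuous γ i (measure_singleton t)⟩

lemma integrable_id_allocationMeasure (hsupp : μ.support = Set.Icc 0 vbar)
    (hγ : IsPositionVector γ) (i : Fin n) : Integrable id (allocationMeasure μ γ i) := by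
  have := isFiniteMeasure_allocationMeasure (μ := μ) hγ i
  refine Integrable.of_mem_Icc 0 vbar aemeasurable_id ?_
  filter_upwards [(allocationMeasure_absolutelyContinuous γ i).ae_le (ae_mem_Ioo hsupp)] with t ht
  exact Set.Ioo_subset_Icc_self ht

lemma allocationMeasure_Iio_zero (hsupp : μ.support = Set.Icc 0 vbar) (γ : Fin k → ℝ)
    (i : Fin n) : allocationMeasure μ γ i (Set.Iio 0) = 0 := by
  refine allocationMeasure_absolutelyContinuous γ i (measure_eq_zero_iff_ae_notMem.2 ?_)
  filter_upwards [ae_mem_Ioo hsupp] with t ht using ht.1.not_gt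

lemma allocationMeasure_Iio_pos (hsupp : μ.support = Set.Icc 0 vbar) (hkn : k < n) (hk : 0 < k)
    (hγ : IsPositionVector γ) (i : Fin n) {v : ℝ} (hv : 0 < v) :
    0 < allocationMeasure μ γ i (Set.Iio v) :=
  pos_iff_ne_zero.2 fun h => (measure_Iio_pos hsupp hv).ne'
    (absolutelyContinuous_allocationMeasure hkn hk hγ i h)

lemma allocationMeasure_real_Iio_pos (hsupp : μ.support = Set.Icc 0 vbar) (hkn : k < n)
    (hk : 0 < k) (hγ : IsPositionVector γ) (i : Fin n) {v : ℝ} (hv : 0 < v) :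
    0 < (allocationMeasure μ γ i).real (Set.Iio v) := by
  have := isFiniteMeasure_allocationMeasure (μ := μ) hγ i
  exact ENNReal.toReal_pos (allocationMeasure_Iio_pos hsupp hkn hk hγ i hv).ne'
    (measure_ne_top _ _)

lemma setIntegral_id_pos (hsupp : μ.support = Set.Icc 0 vbar) (hkn : k < n) (hk : 0 < k)
    (hγ : IsPositionVector γ) (i : Fin n) {v : ℝ} (hv : 0 < v) :
    0 < ∫ t in Set.Iio v, t ∂allocationMeasure μ γ i := by
  have hpos : ∀ᵐ t ∂allocationMeasure μ γ i, 0 < t :=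
    (allocationMeasure_absolutelyContinuous γ i).ae_le ((ae_mem_Ioo hsupp).mono fun t ht => ht.1)
  rw [setIntegral_pos_iff_support_of_nonneg_ae (ae_restrict_of_ae (hpos.mono fun t ht => ht.le))
    (integrable_id_allocationMeasure hsupp hγ i).integrableOn]
  refine (allocationMeasure_Iio_pos hsupp hkn hk hγ i hv).trans_le (measure_mono_ae ?_)
  filter_upwards [hpos] with t ht hmem using ⟨ht.ne', hmem⟩

lemma firstPriceBid_zero (hsupp : μ.support = Set.Icc 0 vbar) (i : Fin n) :
    firstPriceBid μ α β i 0 = 0 := by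
  rw [firstPriceBid, measureReal_def, allocationMeasure_Iio_zero hsupp, ENNReal.toReal_zero,
    div_zero]

lemma firstPriceBid_pos (hsupp : μ.support = Set.Icc 0 vbar) (hkn : k < n) (hk : 0 < k)
    (hα : IsPositionVector α) (hβ : IsPositionVector β) (i : Fin n) {v : ℝ} (hv : 0 < v) :
    0 < firstPriceBid μ α β i v :=
  div_pos (setIntegral_id_pos hsupp hkn hk hβ i hv)
    (allocationMeasure_real_Iio_pos hsupp hkn hk hα i hv)

lemma real_Iio_mul_firstPriceBid (hsupp : μ.support = Set.Icc 0 vbar) (hkn : k < n) (hk : 0 < k)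
    (hα : IsPositionVector α) (i : Fin n) {v : ℝ} (hv : 0 ≤ v) :
    (allocationMeasure μ α i).real (Set.Iio v) * firstPriceBid μ α β i v =
      ∫ t in Set.Iio v, t ∂allocationMeasure μ β i := by
  rcases hv.eq_or_lt with rfl | hv
  · rw [firstPriceBid_zero hsupp, mul_zero,
      setIntegral_measure_zero _ (allocationMeasure_Iio_zero hsupp β i)]
  · exact mul_div_cancel₀ _ (allocationMeasure_real_Iio_pos hsupp hkn hk hα i hv).ne'

lemma continuous_allocationMeasure_real_Iio (hγ : IsPositionVector γ) (i : Fin n) :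
    Continuous fun v => (allocationMeasure μ γ i).real (Set.Iio v) := by
  have := isFiniteMeasure_allocationMeasure (μ := μ) hγ i
  simpa using continuous_setIntegral_Iio (integrable_const (μ := allocationMeasure μ γ i) (1 : ℝ))

lemma measurable_firstPriceBid (hsupp : μ.support = Set.Icc 0 vbar) (hα : IsPositionVector α)
    (hβ : IsPositionVector β) (i : Fin n) : Measurable (firstPriceBid μ α β i) :=
  (continuous_setIntegral_Iio (integrable_id_allocationMeasure hsupp hβ i)).measurable.div
    (continuous_allocationMeasure_real_Iio hα i).measurable

lemma continuousOn_firstPriceBid (hsupp : μ.support = Set.Icc 0 vbar) (hkn : k < n) (hk : 0 < k)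
    (hα : IsPositionVector α) (hβ : IsPositionVector β) (i : Fin n) :
    ContinuousOn (firstPriceBid μ α β i) (Set.Ioi 0) :=
  (continuous_setIntegral_Iio (integrable_id_allocationMeasure hsupp hβ i)).continuousOn.div
    (continuous_allocationMeasure_real_Iio hα i).continuousOn
    fun _ hv => (allocationMeasure_real_Iio_pos hsupp hkn hk hα i hv).ne'

end FirstPriceBid

section TruthfulOutcome

variable {μ : Measure ℝ} [IsProbabilityMeasure μ] {vbar : ℝ} {α β γ : Fin k → ℝ}
  {g : AllocationRule n} {b : ℝ → ℝ} {i : Fin n} {v : ℝ}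

lemma integrableOn_bid (hγ : IsPositionVector γ) (hb : Measurable b)
    (hle : ∀ᵐ t ∂μ, t < v → b t ≤ b v)
    (hint : Integrable (rivalSum γ i ((Set.Iio v).indicator b)) (valueLaw n μ)) :
    IntegrableOn b (Set.Iio v) (allocationMeasure μ γ i) := by
  have := isFiniteMeasure_allocationMeasure (μ := μ) hγ i
  have hconst : Integrable ((Set.Iio v).indicator fun _ => b v) (allocationMeasure μ γ i) :=
    (integrable_const _).indicator measurableSet_Iio
  have hdiff : Integrable ((Set.Iio v).indicator fun t => b v - b t)
      (allocationMeasure μ γ i) := by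
    refine integrable_of_integrable_rivalSum hγ
      ((measurable_const.sub hb).indicator measurableSet_Iio) ?_ ?_
    · filter_upwards [hle] with t ht
      exact Set.indicator_apply_nonneg fun hlt => sub_nonneg.2 (ht hlt)
    · refine ((integrable_rivalSum hγ (measurable_const.indicator measurableSet_Iio)
        hconst).sub hint).congr (Filter.Eventually.of_forall fun w => ?_)
      simp only [Pi.sub_apply, rivalSum, ← Finset.sum_sub_distrib, ← mul_sub,
        Set.indicator_apply]
      grind
  rw [← integrable_indicator_iff measurableSet_Iio]
  refine (hconst.sub hdiff).congr (Filter.Eventually.of_forall fun t => ?_)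
  simp only [Pi.sub_apply, Set.indicator_apply]
  grind

variable [NullSingletonClass μ]

lemma expectedPayment_vcg (hg : IsEfficientRule g) (hkn : k < n) (γ : Fin k → ℝ)
    (hv : ∀ᵐ w ∂valueLaw n μ, StrictMonoOn b (Set.range (Function.update w i v))) :
    expectedPayment (vcg g γ) μ b i (b v) =
      ∫ w, rivalSum γ i ((Set.Iio v).indicator b) w ∂valueLaw n μ := by
  refine integral_congr_ae ?_
  filter_upwards [hv, ae_injective_update i v] with w hmono hinj
  exact hg.vcg_pay_bidProfile hkn γ hinj hmono

lemma expectedPayment_vcg_id (hsupp : μ.support = Set.Icc 0 vbar) (hg : IsEfficientRule g)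
    (hkn : k < n) (hγ : IsPositionVector γ) (i : Fin n) (v : ℝ) :
    expectedPayment (vcg g γ) μ id i v = ∫ t in Set.Iio v, t ∂allocationMeasure μ γ i := by
  have hint : Integrable ((Set.Iio v).indicator id) (allocationMeasure μ γ i) :=
    (integrable_id_allocationMeasure hsupp hγ i).indicator measurableSet_Iio
  have hpay := expectedPayment_vcg (μ := μ) (b := id) (i := i) (v := v) hg hkn γ
    (Filter.Eventually.of_forall fun _ => strictMono_id.strictMonoOn _)
  rw [integral_rivalSum hγ (measurable_id.indicator measurableSet_Iio) hint,
    integral_indicator measurableSet_Iio] at hpay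
  exact hpay

lemma setIntegral_bid_eq (hsupp : μ.support = Set.Icc 0 vbar) (hg : IsEfficientRule g)
    (hkn : k < n) (hk : 0 < k) (hα : IsPositionVector α) (hβ : IsPositionVector β)
    (hb : Measurable b) (hy : YieldsTruthfulVCG (vcg g α) g β μ vbar b) (hv : v ∈ Set.Ioc 0 vbar)
    (hlt : RanksAs μ b (b v) v) :
    IntegrableOn b (Set.Iio v) (allocationMeasure μ α i) ∧
      ∫ t in Set.Iio v, b t ∂allocationMeasure μ α i =
        ∫ t in Set.Iio v, t ∂allocationMeasure μ β i := by
  have hpay : ∫ w, rivalSum α i ((Set.Iio v).indicator b) w ∂valueLaw n μ =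
      ∫ t in Set.Iio v, t ∂allocationMeasure μ β i := by
    rw [← expectedPayment_vcg hg hkn α (ae_strictMonoOn_range_update hg hy.alloc_eq i hlt),
      hy.pay_eq i v ⟨hv.1.le, hv.2⟩, expectedPayment_vcg_id hsupp hg hkn hβ]
  -- The integral on the left is nonzero, so it is not the junk value of a non-integrable function.
  have hint : Integrable (rivalSum α i ((Set.Iio v).indicator b)) (valueLaw n μ) :=
    not_imp_comm.1 integral_undef (hpay ▸ (setIntegral_id_pos hsupp hkn hk hβ i hv.1).ne')
  have hbid : IntegrableOn b (Set.Iio v) (allocationMeasure μ α i) :=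
    integrableOn_bid hα hb (hlt.mono fun t ht h => (ht.1 h).le) hint
  refine ⟨hbid, ?_⟩
  rw [← hpay, integral_rivalSum hα (hb.indicator measurableSet_Iio)
    ((integrable_indicator_iff measurableSet_Iio).2 hbid), integral_indicator measurableSet_Iio]

lemma strictMonoOn_firstPriceBid_inter (hsupp : μ.support = Set.Icc 0 vbar)
    (hg : IsEfficientRule g) (hkn : k < n) (hk : 0 < k) (hα : IsPositionVector α)
    (hβ : IsPositionVector β) (hb : Measurable b)
    (hy : YieldsTruthfulVCG (vcg g α) g β μ vbar b) (i : Fin n) :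
    StrictMonoOn (firstPriceBid μ α β i) (Set.Ioc 0 vbar ∩
      {v | RanksAs μ b (b v) v}) := by
  rintro u ⟨hu, hltu⟩ v ⟨hv, hltv⟩ huv
  have := isFiniteMeasure_allocationMeasure (μ := μ) hα i
  obtain ⟨-, hequ⟩ := setIntegral_bid_eq (i := i) hsupp hg hkn hk hα hβ hb hy hu hltu
  obtain ⟨hint, heqv⟩ := setIntegral_bid_eq (i := i) hsupp hg hkn hk hα hβ hb hy hv hltv
  rw [firstPriceBid_eq_setAverage hequ, firstPriceBid_eq_setAverage heqv]
  refine setAverage_Iio_lt_setAverage_Iio huv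
    (allocationMeasure_Iio_pos hsupp hkn hk hα i hu.1).ne' (fun h => ?_) hint
    ((allocationMeasure_absolutelyContinuous α i).ae_le hltu)
  exact (measure_Ioo_pos hsupp hu.1.le huv hv.2).ne'
    (absolutelyContinuous_allocationMeasure hkn hk hα i h)

lemma strictMonoOn_firstPriceBid (hsupp : μ.support = Set.Icc 0 vbar) (hg : IsEfficientRule g)
    (hkn : k < n) (hk : 0 < k) (hα : IsPositionVector α) (hβ : IsPositionVector β)
    (hb : Measurable b) (hy : YieldsTruthfulVCG (vcg g α) g β μ vbar b) (i : Fin n) :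
    StrictMonoOn (firstPriceBid μ α β i) (Set.Icc 0 vbar) := by
  have hdense : Set.Icc 0 vbar ⊆
      closure {v | RanksAs μ b (b v) v} := by
    rw [← hsupp]
    exact Measure.support_subset_of_isClosed isClosed_closure (Filter.mem_of_superset
      (ae_ranksAs (by omega) hg hb hy.alloc_eq) subset_closure)
  have hIoc : StrictMonoOn (firstPriceBid μ α β i) (Set.Ioc 0 vbar) :=
    strictMonoOn_of_subset_closure Set.ordConnected_Ioc (Set.Ioc_subset_Icc_self.trans hdense)
      ((continuousOn_firstPriceBid hsupp hkn hk hα hβ i).mono fun _ hv => hv.1)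
      (strictMonoOn_firstPriceBid_inter hsupp hg hkn hk hα hβ hb hy i)
  intro u hu v hv huv
  rcases hu.1.eq_or_lt with rfl | hpos
  · rw [firstPriceBid_zero hsupp]
    exact firstPriceBid_pos hsupp hkn hk hα hβ i huv
  · exact hIoc ⟨hpos, hu.2⟩ ⟨hpos.trans huv, hv.2⟩ huv

end TruthfulOutcome

section FirstPriceAuction

variable {μ : Measure ℝ} [IsProbabilityMeasure μ] {α β : Fin k → ℝ} {g : AllocationRule n}
  {b : ℝ → ℝ} {u x : ℝ}

lemma integrable_comp_rivalsAbove (f : ℕ → ℝ) (i : Fin n) (x : ℝ) :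
    Integrable (fun w => f (rivalsAbove i w x)) (valueLaw n μ) := by
  have hle (w : Fin n → ℝ) : rivalsAbove i w x ≤ n :=
    (Finset.card_le_univ _).trans_eq (Fintype.card_fin n)
  refine Integrable.of_bound ((measurable_from_top (f := f)).comp
    (measurable_rivalsAbove i measurable_const)).aestronglyMeasurable
    (∑ j ∈ Finset.range (n + 1), ‖f j‖) (Filter.Eventually.of_forall fun w => ?_)
  exact Finset.single_le_sum (f := fun j => ‖f j‖) (fun j _ => norm_nonneg _)
    (Finset.mem_range_succ_iff.2 (hle w))

variable [NullSingletonClass μ]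

lemma ae_position_bidProfile (hg : IsEfficientRule g) (i : Fin n)
    (hx : RanksAs μ b x u) :
    ∀ᵐ w ∂valueLaw n μ, (g (bidProfile b i x w) i : ℕ) = rivalsAbove i w u := by
  filter_upwards [ae_valueLaw_of_ae hx, ae_valueLaw_of_ae (Measure.ae_ne μ u)] with w hw hne
  have hposition : (g (bidProfile b i x w) i : ℕ) = rivalsAbove i (b ∘ w) x := by
    unfold bidProfile
    rw [hg.position_eq, Function.update_self, rivalsAbove_update, Function.comp_def]
    intro m hm
    rw [Function.update_of_ne hm, Function.update_self]
    grind
  rw [hposition, rivalsAbove, rivalsAbove]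
  refine congrArg Finset.card (Finset.filter_congr fun m _ => ?_)
  grind

lemma ae_utility_gfp (hg : IsEfficientRule g) (α β : Fin k → ℝ) (i : Fin n)
    (hx : RanksAs μ b x u) (v : ℝ) :
    ∀ᵐ w ∂valueLaw n μ, utility (gfp g α) β i (bidProfile b i x w) v =
      entry β (rivalsAbove i w u) * v - entry α (rivalsAbove i w u) * x := by
  filter_upwards [ae_position_bidProfile hg i hx] with w hw
  simp only [utility, gfp, hw, bidProfile_self]

lemma integrable_utility_gfp (hg : IsEfficientRule g) (α β : Fin k → ℝ) (i : Fin n)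
    (hx : RanksAs μ b x u) (v : ℝ) :
    Integrable (fun w => utility (gfp g α) β i (bidProfile b i x w) v) (valueLaw n μ) :=
  (integrable_congr (ae_utility_gfp hg α β i hx v)).2
    (integrable_comp_rivalsAbove (fun j => entry β j * v - entry α j * x) i u)

lemma expectedUtility_gfp (hkn : k < n) (hg : IsEfficientRule g) (hα : IsPositionVector α)
    (hβ : IsPositionVector β) (i : Fin n)
    (hx : RanksAs μ b x u) (v : ℝ) :
    expectedUtility (gfp g α) β μ b i x v =
      (allocationMeasure μ β i).real (Set.Iio u) * v -
        (allocationMeasure μ α i).real (Set.Iio u) * x := by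
  rw [← integral_entry_rivalsAbove hkn hα, ← integral_entry_rivalsAbove hkn hβ,
    ← integral_mul_const, ← integral_mul_const,
    ← integral_sub ((integrable_comp_rivalsAbove _ i u).mul_const v)
      ((integrable_comp_rivalsAbove _ i u).mul_const x)]
  exact integral_congr_ae (ae_utility_gfp hg α β i hx v)

lemma expectedPayment_gfp (hkn : k < n) (hg : IsEfficientRule g) (hα : IsPositionVector α)
    (i : Fin n) (hx : RanksAs μ b x u) :
    expectedPayment (gfp g α) μ b i x = (allocationMeasure μ α i).real (Set.Iio u) * x := by
  rw [← integral_entry_rivalsAbove hkn hα, ← integral_mul_const]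
  refine integral_congr_ae ?_
  filter_upwards [ae_position_bidProfile hg i hx] with w hw
  simp only [gfp, hw, bidProfile_self]

end FirstPriceAuction

section Equilibrium

variable {μ : Measure ℝ} [IsProbabilityMeasure μ] [NullSingletonClass μ] {vbar : ℝ}
  {α β : Fin k → ℝ} {g : AllocationRule n} {i : Fin n} {u v : ℝ}

lemma setIntegral_sub_eq (hsupp : μ.support = Set.Icc 0 vbar) (hkn : k < n) (hk : 0 < k)
    (hα : IsPositionVector α) (hβ : IsPositionVector β) (i : Fin n) (hu : 0 ≤ u) (v : ℝ) :
    ∫ t in Set.Iio u, (v - t) ∂allocationMeasure μ β i =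
      (allocationMeasure μ β i).real (Set.Iio u) * v -
        (allocationMeasure μ α i).real (Set.Iio u) * firstPriceBid μ α β i u := by
  have := isFiniteMeasure_allocationMeasure (μ := μ) hβ i
  rw [integral_sub (g := fun t => t) (integrable_const v)
    (integrable_id_allocationMeasure hsupp hβ i).integrableOn, setIntegral_const, smul_eq_mul,
    real_Iio_mul_firstPriceBid hsupp hkn hk hα i hu]

lemma expectedUtility_gfp_firstPriceBid (hsupp : μ.support = Set.Icc 0 vbar)
    (hg : IsEfficientRule g) (hkn : k < n) (hk : 0 < k) (hα : IsPositionVector α)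
    (hβ : IsPositionVector β) (hB : StrictMonoOn (firstPriceBid μ α β i) (Set.Icc 0 vbar))
    (hu : u ∈ Set.Icc 0 vbar) (v : ℝ) :
    expectedUtility (gfp g α) β μ (firstPriceBid μ α β i) i (firstPriceBid μ α β i u) v =
      ∫ t in Set.Iio u, (v - t) ∂allocationMeasure μ β i := by
  rw [expectedUtility_gfp hkn hg hα hβ i (ranksAs_of_strictMonoOn hsupp hB hu),
    setIntegral_sub_eq hsupp hkn hk hα hβ i hu.1]

lemma exists_ranksAs_firstPriceBid (hsupp : μ.support = Set.Icc 0 vbar)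
    (hkn : k < n) (hk : 0 < k) (hα : IsPositionVector α) (hβ : IsPositionVector β)
    (hvbar : 0 ≤ vbar) (hB : StrictMonoOn (firstPriceBid μ α β i) (Set.Icc 0 vbar)) (x : ℝ) :
    ∃ u ∈ Set.Icc 0 vbar, (u = 0 ∨ firstPriceBid μ α β i u ≤ x) ∧
      RanksAs μ (firstPriceBid μ α β i) x u := by
  obtain ⟨u, hu, hle, hlt⟩ := exists_forall_lt_of_strictMonoOn hvbar hB
    ((continuousOn_firstPriceBid hsupp hkn hk hα hβ i).mono fun _ ht => ht.1) x
  exact ⟨u, hu, hle, (ae_mem_Ioo hsupp).mono hlt⟩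

lemma isBayesNash_gfp (hsupp : μ.support = Set.Icc 0 vbar) (hg : IsEfficientRule g) (hkn : k < n)
    (hk : 0 < k) (hα : IsPositionVector α) (hβ : IsPositionVector β)
    (hB : StrictMonoOn (firstPriceBid μ α β i) (Set.Icc 0 vbar)) :
    IsBayesNash (gfp g α) β μ vbar (firstPriceBid μ α β i) := by
  refine ⟨measurable_firstPriceBid hsupp hα hβ i, fun j v hv x => ?_, fun j v hv x => ?_⟩ <;>
    obtain ⟨u, hu, hle, hx⟩ := exists_ranksAs_firstPriceBid hsupp hkn hk hα hβ
      (hv.1.trans hv.2) hB x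
  · exact integrable_utility_gfp hg α β j hx v
  rw [firstPriceBid_eq α β i j] at hB hle hx ⊢
  have := isFiniteMeasure_allocationMeasure (μ := μ) hβ j
  have hpay : (allocationMeasure μ α j).real (Set.Iio u) * firstPriceBid μ α β j u ≤
      (allocationMeasure μ α j).real (Set.Iio u) * x := by
    rcases hle with rfl | hle
    · simp [measureReal_def, allocationMeasure_Iio_zero hsupp]
    · exact mul_le_mul_of_nonneg_left hle measureReal_nonneg
  calc expectedUtility (gfp g α) β μ (firstPriceBid μ α β j) j x v
      = (allocationMeasure μ β j).real (Set.Iio u) * v -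
          (allocationMeasure μ α j).real (Set.Iio u) * x :=
        expectedUtility_gfp hkn hg hα hβ j hx v
    _ ≤ ∫ t in Set.Iio u, (v - t) ∂allocationMeasure μ β j := by
        rw [setIntegral_sub_eq hsupp hkn hk hα hβ j hu.1]
        exact sub_le_sub_left hpay _
    _ ≤ ∫ t in Set.Iio v, (v - t) ∂allocationMeasure μ β j :=
        setIntegral_Iio_sub_le (integrable_id_allocationMeasure hsupp hβ j) u v
    _ = expectedUtility (gfp g α) β μ (firstPriceBid μ α β j) j (firstPriceBid μ α β j v) v :=
        (expectedUtility_gfp_firstPriceBid hsupp hg hkn hk hα hβ hB hv v).symm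

lemma yieldsTruthfulVCG_gfp (hsupp : μ.support = Set.Icc 0 vbar) (hg : IsEfficientRule g)
    (hkn : k < n) (hk : 0 < k) (hα : IsPositionVector α) (hβ : IsPositionVector β)
    (hB : StrictMonoOn (firstPriceBid μ α β i) (Set.Icc 0 vbar)) :
    YieldsTruthfulVCG (gfp g α) g β μ vbar (firstPriceBid μ α β i) := by
  refine ⟨?_, fun j v hv => ?_⟩
  · filter_upwards [ae_injective, ae_valueLaw_of_ae (ae_mem_Ioo hsupp)] with w hinj hw
    exact hg.comp_eq hinj (hB.mono (Set.range_subset_iff.2 fun l => Set.Ioo_subset_Icc_self (hw l)))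
  · rw [firstPriceBid_eq α β i j] at hB ⊢
    rw [expectedPayment_gfp hkn hg hα j (ranksAs_of_strictMonoOn hsupp hB hv),
      expectedPayment_vcg_id hsupp hg hkn hβ, real_Iio_mul_firstPriceBid hsupp hkn hk hα j hv.1]

lemma obtainsTruthfulVCG_gfp_of_no_positions (α β : Fin 0 → ℝ) (g : AllocationRule n)
    (μ : Measure ℝ) (vbar : ℝ) : ObtainsTruthfulVCG (gfp g α) g β μ vbar := by
  have hzero (γ : Fin 0 → ℝ) (j : ℕ) : entry γ j = 0 := entry_eq_zero γ j.zero_le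
  refine ⟨id, ⟨measurable_id, fun i v _ x => ?_, fun i v _ x => ?_⟩,
    ⟨Filter.Eventually.of_forall fun w => rfl, fun i v _ => ?_⟩⟩
  · simp [utility, gfp, hzero]
  · simp [expectedUtility, utility, gfp, hzero]
  · simp [expectedPayment, vcg, gfp, hzero]

end Equilibrium

end PositionAuction

end

open PositionAuction in
theorem theorem2_general {n k : ℕ} (hkn : k < n) {α β : Fin k → ℝ} (hα : IsPositionVector α)
    (hβ : IsPositionVector β) {μ : Measure ℝ} [IsProbabilityMeasure μ] [NullSingletonClass μ]
    {vbar : ℝ} (hsupp : μ.support = Set.Icc 0 vbar) {g : AllocationRule n}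
    (hg : IsEfficientRule g) {b : ℝ → ℝ} (hb : Measurable b)
    (hy : YieldsTruthfulVCG (vcg g α) g β μ vbar b) :
    ObtainsTruthfulVCG (gfp g α) g β μ vbar := by
  rcases k.eq_zero_or_pos with rfl | hk
  · exact obtainsTruthfulVCG_gfp_of_no_positions α β g μ vbar
  · have hB := strictMonoOn_firstPriceBid hsupp hg hkn hk hα hβ hb hy ⟨0, by omega⟩
    exact ⟨_, isBayesNash_gfp hsupp hg hkn hk hα hβ hB,
      yieldsTruthfulVCG_gfp hsupp hg hkn hk hα hβ hB⟩

theorem theorem2 (n k : ℕ) (hkn : k < n) (α β : Fin k → ℝ)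
    (hα : PositionAuction.IsPositionVector α) (hβ : PositionAuction.IsPositionVector β)
    (μ : MeasureTheory.Measure ℝ) (vbar : ℝ) (hμ : PositionAuction.IsValueDistribution μ vbar)
    (g : PositionAuction.AllocationRule n) (hg : PositionAuction.IsEfficientRule g)
    (hV : PositionAuction.ObtainsTruthfulVCG (PositionAuction.vcg g α) g β μ vbar) :
    PositionAuction.ObtainsTruthfulVCG (PositionAuction.gfp g α) g β μ vbar := by
  have := hμ.isProbabilityMeasure
  have : NullSingletonClass μ := ⟨fun t => hμ.absolutelyContinuous (measure_singleton t)⟩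
  obtain ⟨b, hb, hy⟩ := hV
  exact theorem2_general hkn hα hβ hμ.support_eq hg hb.measurable hy
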